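/- Let $\mathcal H_S\neq 0$ and $\mathcal H_M$ be complex Hilbert spaces (observed system and measuring device), and let $\mathcal H=\mathcal H_S\otimes\mathcal H_M$ be their Hilbert-space tensor product. Let $H$ be a (possibly unbounded) self-adjoint operator on $\mathcal H$ that is bounded from below, and let $U_t=e^{-\frac{i}{\hbar}tH}$, $t\in\mathbb R$, $\hbar>0$, be the evolution of the combined, isolated system. Let $A=\sum_\lambda \lambda P_\lambda$ on $\mathcal H_S$ (the measured observable) and $Z=\sum_\xi \xi\,\Pi_\xi$ on $\mathcal H_M$ (the pointer observable) be self-adjoint operators, where $P_\lambda$ and $\Pi_\xi$ ($\lambda,\xi\in\mathbb R$) are families of mutually orthogonal projections adding up strongly to the identity. Let the ready value $\varnothing\in\mathbb R$ be a number that is not an eigenvalue of $A$, and let the ready state $\varphi_\varnothing\in\Pi_\varnothing\mathcal H_M$ be a unit vector. Let $T<T'$ be real numbers. A vector $\Psi$, regarded as the state at time $T$, is said to have a pointer record $\lambda$ that persists if $U_{t-T}\Psi\in\mathcal H_S\otimes\Pi_\lambda\mathcal H_M$ for all $t\in(T,T')$. 1. (No accurate measurement.) It is impossible that the following two conditions both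 hold: (a) for every unit eigenvector $\psi$ of $A$ and every $\lambda\in\mathbb R$: $\psi\in P_\lambda\mathcal H_S$ if and only if $U_T(\psi\otimes\varphi_\varnothing)=\psi_\lambda(T)\otimes\varphi_\lambda(T)$ for some unit vectors $\psi_\lambda(T)\in\mathcal H_S$ and $\varphi_\lambda(T)\in\Pi_\lambda\mathcal H_M$; (b) for every $\lambda$ and every unit vector $\psi\in P_\lambda\mathcal H_S$, the state $U_T(\psi\otimes\varphi_\varnothing)$ has a pointer record $\lambda$ that persists. 2. (No accurate preparation.) For no unit vector $\psi(0)\in\mathcal H_S$ are there complex coefficients $c_\lambda$ and, for each $\lambda$ with $c_\lambda\ne0$, unit vectors $\psi_\lambda(T)\in P_\lambda\mathcal H_S$ and $\varphi_\lambda(T)\in\Pi_\lambda\mathcal H_M$ such that $$U_T(\psi(0)\otimes\varphi_\varnothing)=\sum_\lambda c_\lambda\,\psi_\lambda(T)\otimes\varphi_\lambda(T)$$ and such that for each $\lambda$ with $c_\lambda\neq0$ the state $\psi_\lambda(T)\otimes\varphi_\lambda(T)$ has a pointer record $\lambda$ that persists. -/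

import Mathlib

open scoped TensorProduct

/-- The Hilbert space of a combined system: the Hilbert space tensor product, that is, the completion
of the algebraic tensor product for the inner product with
`⟪x ⊗ y, x' ⊗ y'⟫ = ⟪x, x'⟫ * ⟪y, y'⟫`. -/
abbrev CombinedSpace (HS HM : Type*)
    [NormedAddCommGroup HS] [InnerProductSpace ℂ HS]
    [NormedAddCommGroup HM] [InnerProductSpace ℂ HM] : Type _ :=
  UniformSpace.Completion (HS ⊗[ℂ] HM)

/-- The product (separable) vector `ψ ⊗ φ` of the combined system. -/
noncomputable def productVec {HS HM : Type*}
    [NormedAddCommGroup HS] [InnerProductSpace ℂ HS]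
    [NormedAddCommGroup HM] [InnerProductSpace ℂ HM] (ψ : HS) (φ : HM) : CombinedSpace HS HM :=
  ((ψ ⊗ₜ[ℂ] φ : HS ⊗[ℂ] HM) : UniformSpace.Completion (HS ⊗[ℂ] HM))

/-- `A = ∑ λ, λ • P λ`: the (possibly unbounded) self-adjoint operator `A` is a sharp observable
with orthogonal projections `P λ`, mutually orthogonal and adding up to the identity.
The eigenvalues are the `λ` with `P λ ≠ 0`, and the eigenspace of `λ` is the range of `P λ`.
Sums converge in norm; `x` is in the domain of `A` exactly if `∑ λ, λ • P λ x` converges. -/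
structure IsSharpObservable {E : Type*} [NormedAddCommGroup E] [InnerProductSpace ℂ E]
    [CompleteSpace E] (A : E →ₗ.[ℂ] E) (P : ℝ → E →L[ℂ] E) : Prop where
  isSelfAdjoint : IsSelfAdjoint A
  isStarProjection : ∀ l : ℝ, IsStarProjection (P l)
  mul_eq_zero : ∀ l m : ℝ, l ≠ m → P l * P m = 0
  hasSum_proj : ∀ x : E, HasSum (fun l : ℝ => P l x) x
  mem_graph_iff : ∀ x y : E, (x, y) ∈ A.graph ↔ HasSum (fun l : ℝ => (l : ℂ) • P l x) y

/-- The operator `H` is bounded from below. -/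
def IsBoundedBelow {E : Type*} [NormedAddCommGroup E] [InnerProductSpace ℂ E]
    (H : E →ₗ.[ℂ] E) : Prop :=
  ∃ c : ℝ, ∀ x : H.domain, c * ‖(x : E)‖ ^ 2 ≤ RCLike.re (inner ℂ (x : E) (H x))

/-- `U t = exp (-(i / ℏ) t H)` for all real `t`: `U` is the strongly continuous one-parameter
unitary group whose infinitesimal generator, with its exact domain, is `-(i / ℏ) H`. -/
structure IsSchrodingerEvolution {E : Type*} [NormedAddCommGroup E] [InnerProductSpace ℂ E]
    (hbar : ℝ) (H : E →ₗ.[ℂ] E) (U : ℝ → E ≃ₗᵢ[ℂ] E) : Prop where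
  map_zero : ∀ x : E, U 0 x = x
  map_add : ∀ (s t : ℝ) (x : E), U (s + t) x = U s (U t x)
  continuous : ∀ x : E, Continuous (fun t : ℝ => U t x)
  mem_graph_iff : ∀ x y : E,
    (x, y) ∈ H.graph ↔ HasDerivAt (fun t : ℝ => U t x) (-(Complex.I / (hbar : ℂ)) • y) 0

section Measurement

variable {HS HM : Type*}
  [NormedAddCommGroup HS] [InnerProductSpace ℂ HS]
  [NormedAddCommGroup HM] [InnerProductSpace ℂ HM]

/-- The closed subspace `HS ⊗ (Q HM)` of the combined space: closed span of the product vectors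
whose pointer factor is in the range of `Q`. -/
noncomputable def recordSpace (HS : Type*) {HM : Type*}
    [NormedAddCommGroup HS] [InnerProductSpace ℂ HS]
    [NormedAddCommGroup HM] [InnerProductSpace ℂ HM] (Q : HM →L[ℂ] HM) :
    Submodule ℂ (CombinedSpace HS HM) :=
  (Submodule.span ℂ {v | ∃ (ψ : HS) (φ : HM), Q φ = φ ∧ v = productVec ψ φ}).topologicalClosure

/-- Pointer persistence for an outcome whose pointer eigenspace is the range of `Q`: the combined
system, being in the state `Ψ` at time `T` and evolving under `U`, has its pointer in the range
of `Q` at all times of the open interval `(T, T')`. -/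
def PointerPersists (U : ℝ → CombinedSpace HS HM ≃ₗᵢ[ℂ] CombinedSpace HS HM)
    (Q : HM →L[ℂ] HM) (T T' : ℝ) (Ψ : CombinedSpace HS HM) : Prop :=
  ∀ t ∈ Set.Ioo T T', U (t - T) Ψ ∈ recordSpace HS Q

/-- Accurate measurement, with the pointer ready in `φ₀` at time `0` and read at time `T`: for each
initial unit eigenvector `ψ` of the measured observable, `ψ ⊗ φ₀` evolves into a product state with
pointer value `l` if and only if the eigenvalue of `ψ` is `l`. -/
def IsAccurateMeasurement (U : ℝ → CombinedSpace HS HM ≃ₗᵢ[ℂ] CombinedSpace HS HM)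
    (P : ℝ → HS →L[ℂ] HS) (Q : ℝ → HM →L[ℂ] HM) (φ₀ : HM) (T : ℝ) : Prop :=
  ∀ ψ : HS, ‖ψ‖ = 1 → (∃ m : ℝ, P m ψ = ψ) → ∀ l : ℝ,
    (P l ψ = ψ ↔ ∃ (ψT : HS) (φT : HM), ‖ψT‖ = 1 ∧ ‖φT‖ = 1 ∧ Q l φT = φT ∧
      U T (productVec ψ φ₀) = productVec ψT φT)

/-- The records of a measurement persist on `(T, T')`: if the system is initially in an eigenstate
for the eigenvalue `l`, then the pointer keeps indicating `l`. -/
def MeasurementPersists (U : ℝ → CombinedSpace HS HM ≃ₗᵢ[ℂ] CombinedSpace HS HM)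
    (P : ℝ → HS →L[ℂ] HS) (Q : ℝ → HM →L[ℂ] HM) (φ₀ : HM) (T T' : ℝ) : Prop :=
  ∀ (l : ℝ) (ψ : HS), ‖ψ‖ = 1 → P l ψ = ψ →
    PointerPersists U (Q l) T T' (U T (productVec ψ φ₀))

/-- Accurate preparation from the initial state `ψ₀` of the system, with the pointer ready in `φ₀`
at time `0` and read at time `T`: the final state is `∑ l, c l • (ψT l ⊗ φT l)` where, for each
outcome `l` that occurs, `φT l` is a pointer state with value `l` and `ψT l` is an eigenstate
of the observable with eigenvalue `l`. -/
def IsAccuratePreparation (U : ℝ → CombinedSpace HS HM ≃ₗᵢ[ℂ] CombinedSpace HS HM)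
    (P : ℝ → HS →L[ℂ] HS) (Q : ℝ → HM →L[ℂ] HM) (φ₀ : HM) (T : ℝ) (ψ₀ : HS)
    (c : ℝ → ℂ) (ψT : ℝ → HS) (φT : ℝ → HM) : Prop :=
  (∀ l : ℝ, c l ≠ 0 → ‖ψT l‖ = 1 ∧ P l (ψT l) = ψT l ∧ ‖φT l‖ = 1 ∧ Q l (φT l) = φT l) ∧
  HasSum (fun l : ℝ => c l • productVec (ψT l) (φT l)) (U T (productVec ψ₀ φ₀))

/-- The records of a preparation persist on `(T, T')`: once an outcome `l` that occurs has been
retained at time `T`, the pointer keeps indicating `l`. -/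
def PreparationPersists (U : ℝ → CombinedSpace HS HM ≃ₗᵢ[ℂ] CombinedSpace HS HM)
    (Q : ℝ → HM →L[ℂ] HM) (T T' : ℝ) (c : ℝ → ℂ) (ψT : ℝ → HS) (φT : ℝ → HM) : Prop :=
  ∀ l : ℝ, c l ≠ 0 → PointerPersists U (Q l) T T' (productVec (ψT l) (φT l))

end Measurement

/-!
Persistence of a record is impossible because the past of an orbit is determined by any short
piece of it, once the Hamiltonian is bounded from below. If `U t Ψ` stays in a closed subspace
`V` during some interval of time, then it stays in `V` for all real `t`
(`IsSchrodingerEvolution.mem_of_mem_on_interval`). Hence a record `l` that persists during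
`(T, T')` can be propagated back to time `0`, where the pointer is in the ready state, which is
orthogonal to every record `l ≠ ready`. In a measurement the state at time `0` is `ψ ⊗ φ₀` with
`ψ` an eigenvector, so `ψ ⊗ φ₀` is orthogonal to itself; in a preparation it is a convergent sum
of vectors that are each orthogonal to `ψ₀ ⊗ φ₀`, with the same conclusion. The ready value is
not an eigenvalue of the measured observable, so the outcomes `l` that occur do differ from it.

The statement about orbits rests on two facts. Subtracting a lower bound `c` from `H` changes
`U t` only by a phase, so let `K = H - c ≥ 0`, with time in units where `ℏ = 1`. The orbit
`exp (-i t K) x` is the boundary value of `F z = exp (-z K) x`, continuous on the closed right half-plane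
and holomorphic inside (`IsPositiveSelfAdjointGraph.exists_holomorphic_continuation`); and a
function of this kind that vanishes on an interval of the boundary vanishes identically
(`eq_zero_of_eq_zero_on_boundary_interval`), which is applied to `⟪w, F z⟫` for `w ⟂ V`.

Without a spectral theorem for unbounded operators, `F` is obtained from the Yosida
approximations `Bₙ = r (1 - (1 + K / r)⁻¹)` with `r = n + 1`, which are bounded and positive.
The entire functions `exp (-z Bₙ) x` are bounded by `‖x‖` for `0 ≤ re z`, and for `x` in the
domain of `K` they converge uniformly on bounded subsets of the closed half-plane by a Duhamel
estimate (`norm_sub_exp_apply_le`); the same estimate identifies the limit on the imaginary axis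
with the given unitary group.
-/

open Filter Topology

/-! ### Positive self-adjoint operators and their resolvents -/

section PositiveGraph

variable {E : Type*} [NormedAddCommGroup E] [InnerProductSpace ℂ E]

/-- `G` is the graph of a positive self-adjoint operator: the domain is dense, the graph equals the
graph of the adjoint, and `0 ≤ ⟪x, y⟫` for `(x, y)` in the graph. Working with the graph avoids
arithmetic of partially defined operators. -/
structure IsPositiveSelfAdjointGraph (G : Submodule ℂ (E × E)) : Prop where
  dense : Dense {x : E | ∃ y, (x, y) ∈ G}
  mem_iff : ∀ x y : E, (x, y) ∈ G ↔ ∀ a b : E, (a, b) ∈ G → inner ℂ b x = inner ℂ a y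
  nonneg : ∀ x y : E, (x, y) ∈ G → 0 ≤ (inner ℂ x y).re

namespace IsPositiveSelfAdjointGraph

variable {G : Submodule ℂ (E × E)}

lemma im_inner (hG : IsPositiveSelfAdjointGraph G) {x y : E} (h : (x, y) ∈ G) :
    (inner ℂ x y).im = 0 := by
  have h1 := (hG.mem_iff x y).1 h x y h
  have h2 : (starRingEnd ℂ) (inner ℂ x y) = inner ℂ x y := by rw [inner_conj_symm, h1]
  exact Complex.conj_eq_iff_im.1 h2

lemma isClosed (hG : IsPositiveSelfAdjointGraph G) : IsClosed (G : Set (E × E)) := by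
  have : (G : Set (E × E)) =
      ⋂ (p : E × E) (_ : p ∈ G), {q | inner ℂ p.2 q.1 = inner ℂ p.1 q.2} := by
    ext q
    simp only [SetLike.mem_coe, Set.mem_iInter, Set.mem_ofPred_eq]
    exact ⟨fun h p hp => (hG.mem_iff q.1 q.2).1 h p.1 p.2 hp,
      fun h => (hG.mem_iff q.1 q.2).2 fun a b hab => h (a, b) hab⟩
  rw [this]
  exact isClosed_biInter fun p _ => isClosed_eq (by fun_prop) (by fun_prop)

lemma sq_norm_add_le (hG : IsPositiveSelfAdjointGraph G) {r : ℝ} (hr : 0 < r) {x y : E}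
    (h : (x, y) ∈ G) :
    ‖x‖ ^ 2 + ‖(r⁻¹ : ℂ) • y‖ ^ 2 ≤ ‖x + (r⁻¹ : ℂ) • y‖ ^ 2 := by
  have h1 : (inner ℂ x ((r⁻¹ : ℂ) • y)).re = r⁻¹ * (inner ℂ x y).re := by
    rw [inner_smul_right, ← Complex.ofReal_inv, Complex.re_ofReal_mul]
  have h2 := norm_add_sq (𝕜 := ℂ) x ((r⁻¹ : ℂ) • y)
  have h3 := mul_nonneg (inv_pos.2 hr).le (hG.nonneg x y h)
  simp only [RCLike.re_to_complex] at h2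
  rw [h1] at h2
  linarith

lemma norm_fst_le (hG : IsPositiveSelfAdjointGraph G) {r : ℝ} (hr : 0 < r) {x y : E}
    (h : (x, y) ∈ G) : ‖x‖ ≤ ‖x + (r⁻¹ : ℂ) • y‖ :=
  le_of_sq_le_sq (by nlinarith [hG.sq_norm_add_le hr h, sq_nonneg ‖(r⁻¹ : ℂ) • y‖])
    (norm_nonneg _)

lemma norm_snd_le (hG : IsPositiveSelfAdjointGraph G) {r : ℝ} (hr : 0 < r) {x y : E}
    (h : (x, y) ∈ G) : ‖y‖ ≤ r * ‖x + (r⁻¹ : ℂ) • y‖ := by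
  have h1 : ‖(r⁻¹ : ℂ) • y‖ ≤ ‖x + (r⁻¹ : ℂ) • y‖ :=
    le_of_sq_le_sq (by nlinarith [hG.sq_norm_add_le hr h, sq_nonneg ‖x‖]) (norm_nonneg _)
  rw [norm_smul, norm_inv, Complex.norm_real, Real.norm_of_nonneg hr.le] at h1
  rwa [inv_mul_le_iff₀ hr] at h1

lemma resolvent_eq (hG : IsPositiveSelfAdjointGraph G) {r : ℝ} (hr : 0 < r) {J : E →L[ℂ] E}
    (hJ : ∀ u, (J u, (r : ℂ) • (u - J u)) ∈ G) {x u : E} (h : (x, (r : ℂ) • (u - x)) ∈ G) :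
    J u = x := by
  have h1 := hG.norm_fst_le hr (G.sub_mem (hJ u) h)
  have hr' : (r : ℂ) ≠ 0 := by exact_mod_cast hr.ne'
  have h2 : J u - x + (r⁻¹ : ℂ) • ((r : ℂ) • (u - J u) - (r : ℂ) • (u - x)) = 0 := by
    rw [← smul_sub, inv_smul_smul₀ hr']; abel
  dsimp only at h1
  rw [h2, norm_zero] at h1
  exact sub_eq_zero.1 (norm_le_zero_iff.1 h1)

/-- A linear map that leaves the graph of `K` invariant commutes with the resolvents of `K`. -/
lemma resolvent_comm (hG : IsPositiveSelfAdjointGraph G) {r : ℝ} (hr : 0 < r) {J : E →L[ℂ] E}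
    (hJ : ∀ u, (J u, (r : ℂ) • (u - J u)) ∈ G) (T : E →ₗ[ℂ] E)
    (hT : ∀ x y, (x, y) ∈ G → (T x, T y) ∈ G) (u : E) : J (T u) = T (J u) := by
  refine hG.resolvent_eq hr hJ ?_
  have := hT _ _ (hJ u)
  rwa [map_smul, map_sub] at this

/-- `J K x = r (x - J x)` on the domain of `K`. -/
lemma resolvent_snd (hG : IsPositiveSelfAdjointGraph G) {r : ℝ} (hr : 0 < r) {J : E →L[ℂ] E}
    (hJ : ∀ u, (J u, (r : ℂ) • (u - J u)) ∈ G) {x y : E} (h : (x, y) ∈ G) :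
    J y = (r : ℂ) • (x - J x) := by
  have hr' : (r : ℂ) ≠ 0 := by exact_mod_cast hr.ne'
  have h1 : J (x + (r⁻¹ : ℂ) • y) = x :=
    hG.resolvent_eq hr hJ (by rwa [add_sub_cancel_left, smul_inv_smul₀ hr'])
  rw [map_add, map_smul] at h1
  rw [← eq_sub_iff_add_eq'.2 h1, smul_inv_smul₀ hr']

lemma resolvent_mem (hG : IsPositiveSelfAdjointGraph G) {r : ℝ} (hr : 0 < r) {J : E →L[ℂ] E}
    (hJ : ∀ u, (J u, (r : ℂ) • (u - J u)) ∈ G) {x y : E} (h : (x, y) ∈ G) :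
    (J x, J y) ∈ G := by
  rw [hG.resolvent_snd hr hJ h]
  exact hJ x

/-- The Yosida approximation `B = r (1 - J)` is a positive operator, so `-z B` is dissipative for
`0 ≤ re z`: with `x = J u` one has `⟪u, B u⟫ = ⟪x, K x⟫ + ‖B u‖² / r`. -/
lemma re_inner_yosida_nonpos (hG : IsPositiveSelfAdjointGraph G) {r : ℝ} (hr : 0 < r)
    {J : E →L[ℂ] E} (hJ : ∀ u, (J u, (r : ℂ) • (u - J u)) ∈ G) {z : ℂ} (hz : 0 ≤ z.re) (u : E) :
    (inner ℂ u (z • -((r : ℂ) • (u - J u)))).re ≤ 0 := by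
  have hr' : (r : ℂ) ≠ 0 := by exact_mod_cast hr.ne'
  set b := (r : ℂ) • (u - J u) with hb
  have hu : u = J u + (r⁻¹ : ℂ) • b := by rw [hb, inv_smul_smul₀ hr']; abel
  have h1 : inner ℂ u b = inner ℂ (J u) b + ((r⁻¹ * ‖b‖ ^ 2 : ℝ) : ℂ) := by
    conv_lhs => rw [hu]
    rw [inner_add_left, inner_smul_left, inner_self_eq_norm_sq_to_K, map_inv₀,
      Complex.conj_ofReal]
    push_cast; rfl
  have him : (inner ℂ u b).im = 0 := by
    rw [h1, Complex.add_im, hG.im_inner (hJ u), Complex.ofReal_im, add_zero]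
  have hre : 0 ≤ (inner ℂ u b).re := by
    rw [h1, Complex.add_re, Complex.ofReal_re]
    have := hG.nonneg _ _ (hJ u)
    positivity
  rw [inner_smul_right, inner_neg_right, Complex.mul_re, Complex.neg_re, Complex.neg_im, him]
  nlinarith

variable [CompleteSpace E]

/-- A positive self-adjoint operator `K` has a resolvent `J = (1 + K / r)⁻¹`, an everywhere defined
contraction. The range of `1 + K / r` is closed because `1 + K / r` is bounded below, and dense
because a vector orthogonal to it would be an eigenvector of `K` for the eigenvalue `-r`. -/
lemma exists_resolvent (hG : IsPositiveSelfAdjointGraph G) {r : ℝ} (hr : 0 < r) :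
    ∃ J : E →L[ℂ] E, (∀ u, (J u, (r : ℂ) • (u - J u)) ∈ G) ∧ ∀ u, ‖J u‖ ≤ ‖u‖ := by
  have hr' : (r : ℂ) ≠ 0 := by exact_mod_cast hr.ne'
  let S : G →L[ℂ] E :=
    (ContinuousLinearMap.fst ℂ E E + (r⁻¹ : ℂ) • ContinuousLinearMap.snd ℂ E E).comp G.subtypeL
  have hS : ∀ p : G, S p = (p : E × E).1 + (r⁻¹ : ℂ) • (p : E × E).2 := fun p => rfl
  have hbound : ∀ p : G, ‖p‖ ≤ ((1 + r).toNNReal : ℝ) * ‖S p‖ := by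
    rintro ⟨⟨x, y⟩, hp⟩
    rw [hS, Real.coe_toNNReal _ (by positivity)]
    have h1 := hG.norm_fst_le hr hp
    have h2 := hG.norm_snd_le hr hp
    have h0 := norm_nonneg (x + (r⁻¹ : ℂ) • y)
    change max ‖x‖ ‖y‖ ≤ _
    refine max_le ?_ ?_ <;> dsimp only <;> nlinarith
  have hanti := S.antilipschitz_of_bound hbound
  have : CompleteSpace G := hG.isClosed.completeSpace_coe
  have hclosed : IsClosed (S.range : Set E) := by
    rw [LinearMap.coe_range]
    exact hanti.isClosed_range S.uniformContinuous
  have hperp : S.rangeᗮ = ⊥ := by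
    rw [Submodule.eq_bot_iff]
    intro v hv
    have hv' : ∀ a b : E, (a, b) ∈ G → inner ℂ b v = inner ℂ a (-(r : ℂ) • v) := by
      intro a b hab
      have h1 : inner ℂ (a + (r⁻¹ : ℂ) • b) v = 0 :=
        (Submodule.mem_orthogonal _ _).1 hv _ ⟨⟨(a, b), hab⟩, rfl⟩
      rw [inner_add_left, inner_smul_left, map_inv₀, Complex.conj_ofReal] at h1
      rw [inner_smul_right]
      field_simp at h1
      linear_combination h1
    have h2 := hG.nonneg _ _ ((hG.mem_iff v _).2 hv')
    have h3 : (inner ℂ v (-(r : ℂ) • v)).re = -r * ‖v‖ ^ 2 := by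
      rw [inner_smul_right, inner_self_eq_norm_sq_to_K, ← Complex.ofReal_neg,
        Complex.re_ofReal_mul]
      norm_cast
    rw [h3] at h2
    have h4 : ‖v‖ ^ 2 ≤ 0 := by nlinarith
    exact norm_eq_zero.1 (pow_eq_zero_iff two_ne_zero |>.1 (le_antisymm h4 (sq_nonneg _)))
  have hrange : S.range = ⊤ := by
    rw [← hclosed.submodule_topologicalClosure_eq]
    exact (Submodule.topologicalClosure_eq_top_iff).2 hperp
  let e : G ≃ₗ[ℂ] E := LinearEquiv.ofBijective S.toLinearMap
    ⟨hanti.injective, LinearMap.range_eq_top.1 hrange⟩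
  have he : ∀ u, ((e.symm u : G) : E × E).1 + (r⁻¹ : ℂ) • ((e.symm u : G) : E × E).2 = u :=
    fun u => e.apply_symm_apply u
  have hle : ∀ u, ‖((e.symm u : G) : E × E).1‖ ≤ ‖u‖ := fun u => by
    have := hG.norm_fst_le hr (x := ((e.symm u : G) : E × E).1) (e.symm u).2
    rwa [he] at this
  refine ⟨((LinearMap.fst ℂ E E).comp (G.subtype.comp e.symm.toLinearMap)).mkContinuous 1
    fun u => by simpa using hle u, fun u => ?_, hle⟩
  have h1 : (r : ℂ) • (u - ((e.symm u : G) : E × E).1) = ((e.symm u : G) : E × E).2 := by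
    rw [sub_eq_iff_eq_add'.2 (he u).symm, smul_inv_smul₀ hr']
  change (((e.symm u : G) : E × E).1, (r : ℂ) • (u - ((e.symm u : G) : E × E).1)) ∈ G
  rw [h1]
  exact (e.symm u).2

end IsPositiveSelfAdjointGraph

end PositiveGraph

/-! ### Exponentials of bounded dissipative operators -/

section Exponential

variable {E : Type*} [NormedAddCommGroup E] [InnerProductSpace ℂ E]

lemma hasDerivAt_clm_apply {V : ℝ → E →L[ℂ] E} {V' : E →L[ℂ] E} {g : ℝ → E} {g' : E} {s : ℝ}
    (hV : HasDerivAt V V' s) (hg : HasDerivAt g g' s) :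
    HasDerivAt (fun t => V t (g t)) (V' (g s) + V s g') s := by
  have h := ((ContinuousLinearMap.restrictScalarsL ℂ E E ℝ ℝ).hasFDerivAt.comp_hasDerivAt s
    hV).clm_apply hg
  exact h

variable [CompleteSpace E]

/-- A bounded dissipative operator generates a contraction semigroup. -/
lemma norm_exp_smul_apply_le {C : E →L[ℂ] E} (hC : ∀ y, (inner ℂ y (C y)).re ≤ 0) {s : ℝ}
    (hs : 0 ≤ s) (x : E) : ‖NormedSpace.exp (s • C) x‖ ≤ ‖x‖ := by
  let g : ℝ → E := fun s => NormedSpace.exp (s • C) x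
  have hg : ∀ t, HasDerivAt g (C (g t)) t := fun t => by
    have h := hasDerivAt_clm_apply (hasDerivAt_exp_smul_const' C t) (hasDerivAt_const t x)
    simpa [g] using h
  have hn : ∀ t, HasDerivAt (fun t => ‖g t‖ ^ 2) (2 * (inner ℂ (g t) (C (g t))).re) t := by
    intro t
    let _ : InnerProductSpace ℝ E := InnerProductSpace.rclikeToReal ℂ E
    exact (hg t).norm_sq
  have hanti : Antitone fun t => ‖g t‖ ^ 2 :=
    antitone_of_deriv_nonpos (fun t => (hn t).differentiableAt) fun t => by
      rw [(hn t).deriv]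
      linarith [hC (g t)]
  have h := hanti hs
  simp only [g, zero_smul, NormedSpace.exp_zero, one_apply_eq_self] at h
  exact le_of_sq_le_sq h (norm_nonneg _)

/-- Duhamel estimate: a curve that solves `g' = C g` up to an error `δ` stays `δ`-close, over unit
time, to the exact solution. -/
lemma norm_sub_exp_apply_le {C : E →L[ℂ] E} (hC : ∀ y, (inner ℂ y (C y)).re ≤ 0) {g : ℝ → E}
    {h : ℝ → E} {δ : ℝ} (hg : ∀ s, HasDerivAt g (C (g s) + h s) s) (hh : ∀ s, 0 ≤ s → ‖h s‖ ≤ δ) :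
    ‖g 1 - NormedSpace.exp C (g 0)‖ ≤ δ := by
  -- `p` interpolates between `exp C (g 0)` and `g 1`
  let p : ℝ → E := fun s => NormedSpace.exp ((1 - s) • C) (g s)
  have hp : ∀ s, HasDerivAt p (NormedSpace.exp ((1 - s) • C) (h s)) s := fun s => by
    have h1 : HasDerivAt (fun s : ℝ => NormedSpace.exp ((1 - s) • C))
        ((-1 : ℝ) • (NormedSpace.exp ((1 - s) • C) * C)) s :=
      (hasDerivAt_exp_smul_const C (1 - s)).scomp s ((hasDerivAt_id s).const_sub 1)
    convert hasDerivAt_clm_apply h1 (hg s) using 1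
    simp
  have h2 := norm_image_sub_le_of_norm_deriv_le_segment_01' (f := p) (C := δ)
    (fun s _ => (hp s).hasDerivWithinAt) fun s hs =>
      (norm_exp_smul_apply_le hC (by linarith [hs.2]) _).trans (hh s hs.1)
  simpa [p] using h2

end Exponential

/-! ### Boundary uniqueness for holomorphic functions on a half-plane -/

section BoundaryUniqueness

/-- A function on the closed right half-plane, holomorphic inside, that vanishes on an interval of
the imaginary axis centred at `i t`, vanishes on the horizontal segment next to `i t`.
On the square with centre `q = i t + δ` and half side `δ`, whose left edge lies on the interval, the
product of the four functions that arise from `f` by quarter turns about `q` vanishes on the whole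
boundary; by the maximum principle it vanishes at `q`, where it equals `f q ^ 4`. -/
lemma eq_zero_of_eq_zero_on_edge {f : ℂ → ℂ} (hc : ContinuousOn f {z | 0 ≤ z.re})
    (hd : DifferentiableOn ℂ f {z | 0 < z.re}) {t δ : ℝ} (hδ : 0 < δ)
    (h0 : ∀ s : ℝ, |s - t| ≤ δ → f (Complex.I * s) = 0) : f (δ + Complex.I * t) = 0 := by
  set q : ℂ := δ + Complex.I * t with hq
  have hqre : q.re = δ := by simp [hq]
  have hqim : q.im = t := by simp [hq]
  let U : Set ℂ := {w | |w.re| < δ ∧ |w.im| < δ}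
  let U' : Set ℂ := {w | |w.re| ≤ δ ∧ |w.im| ≤ δ}
  have hUo : IsOpen U := by
    have h1 : Continuous fun w : ℂ => |w.re| := by fun_prop
    have h2 : Continuous fun w : ℂ => |w.im| := by fun_prop
    exact (isOpen_lt h1 continuous_const).inter (isOpen_lt h2 continuous_const)
  have hU'c : IsClosed U' := by
    have h1 : Continuous fun w : ℂ => |w.re| := by fun_prop
    have h2 : Continuous fun w : ℂ => |w.im| := by fun_prop
    exact (isClosed_le h1 continuous_const).inter (isClosed_le h2 continuous_const)
  have hUU' : closure U ⊆ U' := closure_minimal (fun w hw => ⟨hw.1.le, hw.2.le⟩) hU'c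
  have hUb : Bornology.IsBounded U := by
    refine (Metric.isBounded_iff_subset_closedBall 0).2 ⟨δ + δ, fun w hw => ?_⟩
    rw [mem_closedBall_zero_iff]
    exact (Complex.norm_le_abs_re_add_abs_im w).trans (add_le_add hw.1.le hw.2.le)
  -- each of the four rotated copies is continuous on the closed square, holomorphic inside
  have hdc : ∀ c : ℂ, (∀ w ∈ U', |(c * w).re| ≤ δ) → (∀ w ∈ U, |(c * w).re| < δ) →
      DiffContOnCl ℂ (fun w => f (q + c * w)) U := by
    intro c h1 h2
    refine ⟨?_, ?_⟩
    · refine hd.comp (by fun_prop) fun w hw => ?_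
      have := neg_lt_of_abs_lt (h2 w hw)
      simp only [Set.mem_ofPred_eq, Complex.add_re, hqre]
      linarith
    · refine hc.comp (by fun_prop) fun w hw => ?_
      have := neg_le_of_abs_le (h1 w (hUU' hw))
      simp only [Set.mem_ofPred_eq, Complex.add_re, hqre]
      linarith
  let g : ℂ → ℂ := fun w =>
    f (q + 1 * w) * (f (q + -1 * w) * (f (q + Complex.I * w) * f (q + -Complex.I * w)))
  have hg : DiffContOnCl ℂ g U := by
    have e1 := hdc 1 (fun w hw => by simpa using hw.1) (fun w hw => by simpa using hw.1)
    have e2 := hdc (-1) (fun w hw => by simpa using hw.1) (fun w hw => by simpa using hw.1)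
    have e3 := hdc Complex.I (fun w hw => by simpa using hw.2) (fun w hw => by simpa using hw.2)
    have e4 := hdc (-Complex.I) (fun w hw => by simpa using hw.2) (fun w hw => by simpa using hw.2)
    exact ⟨e1.1.mul (e2.1.mul (e3.1.mul e4.1)), e1.2.mul (e2.2.mul (e3.2.mul e4.2))⟩
  have hedge : ∀ v : ℂ, v.re = -δ → |v.im| ≤ δ → f (q + v) = 0 := by
    intro v h1 h2
    have : q + v = Complex.I * ((t + v.im : ℝ) : ℂ) := by
      apply Complex.ext <;> simp [hqre, hqim, h1]
    rw [this]
    exact h0 _ (by simpa using h2)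
  have hfr : Set.EqOn g 0 (frontier U) := by
    intro w hw
    rw [hUo.frontier_eq] at hw
    obtain ⟨hre, him⟩ := hUU' hw.1
    have hor : |w.re| = δ ∨ |w.im| = δ := by
      by_contra! h
      exact hw.2 ⟨lt_of_le_of_ne hre h.1, lt_of_le_of_ne him h.2⟩
    simp only [g, Pi.zero_apply, mul_eq_zero]
    rcases hor with h | h <;> rcases (abs_eq hδ.le).1 h with h | h
    · exact Or.inr (Or.inl (hedge _ (by simp [h]) (by simpa using him)))
    · exact Or.inl (hedge _ (by simp [h]) (by simpa using him))
    · exact Or.inr (Or.inr (Or.inl (hedge _ (by simp [h]) (by simpa using hre))))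
    · exact Or.inr (Or.inr (Or.inr (hedge _ (by simp [h]) (by simpa using hre))))
  have h := Complex.eqOn_of_eqOn_frontier hUb hg diffContOnCl_const hfr
    (show (0 : ℂ) ∈ U by simp [U, hδ])
  have hq4 : f q * (f q * (f q * f q)) = 0 := by
    have h' : g 0 = 0 := h
    simpa only [g, mul_zero, add_zero] using h'
  simpa using hq4

/-- Boundary uniqueness: a function on the closed right half-plane, holomorphic inside, that
vanishes on an interval of the imaginary axis vanishes identically. -/
lemma eq_zero_of_eq_zero_on_boundary_interval {f : ℂ → ℂ} (hc : ContinuousOn f {z | 0 ≤ z.re})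
    (hd : DifferentiableOn ℂ f {z | 0 < z.re}) {a b : ℝ} (hab : a < b)
    (h0 : ∀ t ∈ Set.Ioo a b, f (Complex.I * t) = 0) {z : ℂ} (hz : 0 ≤ z.re) : f z = 0 := by
  set t := (a + b) / 2 with ht
  set d := (b - a) / 2 with hd'
  have hdpos : 0 < d := by rw [hd']; linarith
  have hseg : ∀ δ : ℝ, 0 < δ → δ < d → f (δ + Complex.I * t) = 0 := fun δ hδ hδd =>
    eq_zero_of_eq_zero_on_edge hc hd hδ fun s hs => h0 s (by
      have := abs_le.1 hs
      constructor <;> linarith)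
  have hopen : IsOpen {z : ℂ | 0 < z.re} := isOpen_lt continuous_const Complex.continuous_re
  have hpre : IsPreconnected {z : ℂ | 0 < z.re} := (convex_halfSpace_re_gt 0).isPreconnected
  have hint : Set.EqOn f 0 {z | 0 < z.re} := by
    refine (hd.analyticOnNhd hopen).eqOn_zero_of_preconnected_of_frequently_eq_zero hpre
      (z₀ := ((d / 2 : ℝ) : ℂ) + Complex.I * t) (by simp [hdpos]) ?_
    have htend : Tendsto (fun δ : ℝ => (δ : ℂ) + Complex.I * t) (𝓝[≠] (d / 2))
        (𝓝[≠] (((d / 2 : ℝ) : ℂ) + Complex.I * t)) := by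
      refine tendsto_nhdsWithin_of_tendsto_nhds_of_eventually_within _ ?_ ?_
      · exact ((by fun_prop : Continuous fun δ : ℝ => (δ : ℂ) + Complex.I * t).tendsto _).mono_left
          nhdsWithin_le_nhds
      · filter_upwards [self_mem_nhdsWithin] with δ hδ
        have : δ ≠ d / 2 := hδ
        simp only [Set.mem_compl_iff, Set.mem_singleton_iff, add_left_inj]
        exact_mod_cast this
    refine htend.frequently (Eventually.frequently ?_)
    have : Set.Ioo 0 d ∈ 𝓝 (d / 2) := Ioo_mem_nhds (by linarith) (by linarith)
    filter_upwards [nhdsWithin_le_nhds this] with δ hδ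
    exact hseg δ hδ.1 hδ.2
  have hsub : {z : ℂ | 0 < z.re} ⊆ {z : ℂ | 0 ≤ z.re} := fun w (hw : 0 < w.re) => hw.le
  refine hint.of_subset_closure hc continuousOn_const hsub ?_ hz
  rw [Complex.closure_setOfPred_lt_re]

end BoundaryUniqueness

/-! ### Yosida approximation and continuation to complex time -/

section Continuation

variable {E : Type*} [NormedAddCommGroup E] [InnerProductSpace ℂ E]

/-- The Yosida approximation `r (1 - J)` of an operator with resolvent `J = (1 + K / r)⁻¹`. -/
noncomputable def yosida (r : ℝ) (J : E →L[ℂ] E) : E →L[ℂ] E := (r : ℂ) • (1 - J)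

lemma yosida_apply (r : ℝ) (J : E →L[ℂ] E) (u : E) : yosida r J u = (r : ℂ) • (u - J u) := by
  simp [yosida]

namespace IsPositiveSelfAdjointGraph

variable {G : Submodule ℂ (E × E)}

lemma dissipative_yosida (hG : IsPositiveSelfAdjointGraph G) {r : ℝ} (hr : 0 < r)
    {J : E →L[ℂ] E} (hJ : ∀ u, (J u, (r : ℂ) • (u - J u)) ∈ G) {z : ℂ} (hz : 0 ≤ z.re) (u : E) :
    (inner ℂ u ((z • -yosida r J) u)).re ≤ 0 := by
  have := hG.re_inner_yosida_nonpos hr hJ hz u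
  rwa [← yosida_apply] at this

lemma commute_yosida (hG : IsPositiveSelfAdjointGraph G) {r s : ℝ} (hr : 0 < r) (hs : 0 < s)
    {J L : E →L[ℂ] E} (hJ : ∀ u, (J u, (r : ℂ) • (u - J u)) ∈ G)
    (hL : ∀ u, (L u, (s : ℂ) • (u - L u)) ∈ G) : Commute (yosida r J) (yosida s L) := by
  have h : Commute J L := ContinuousLinearMap.ext fun u =>
    hG.resolvent_comm hr hJ L.toLinearMap (fun _ _ h => hG.resolvent_mem hs hL h) u
  have h1 : Commute (1 - J) (1 - L) :=
    ((Commute.one_left _).sub_left ((Commute.one_right J).sub_right h))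
  exact (h1.smul_left (r : ℂ)).smul_right (s : ℂ)

lemma norm_resolvent_le (hG : IsPositiveSelfAdjointGraph G) {r : ℝ} (hr : 0 < r)
    {J : E →L[ℂ] E} (hJ : ∀ u, (J u, (r : ℂ) • (u - J u)) ∈ G) (u : E) : ‖J u‖ ≤ ‖u‖ := by
  have hr' : (r : ℂ) ≠ 0 := by exact_mod_cast hr.ne'
  have h := hG.norm_fst_le hr (hJ u)
  rwa [inv_smul_smul₀ hr', add_sub_cancel] at h

lemma yosida_eq (hG : IsPositiveSelfAdjointGraph G) {r : ℝ} (hr : 0 < r)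
    {J : E →L[ℂ] E} (hJ : ∀ u, (J u, (r : ℂ) • (u - J u)) ∈ G) {x y : E} (h : (x, y) ∈ G) :
    yosida r J x = J y := by
  rw [yosida_apply, hG.resolvent_snd hr hJ h]

lemma norm_sub_resolvent_le (hG : IsPositiveSelfAdjointGraph G) {r : ℝ} (hr : 0 < r)
    {J : E →L[ℂ] E} (hJ : ∀ u, (J u, (r : ℂ) • (u - J u)) ∈ G) {x y : E} (h : (x, y) ∈ G) :
    ‖x - J x‖ ≤ ‖y‖ / r := by
  have h1 := hG.norm_resolvent_le hr hJ y
  rw [hG.resolvent_snd hr hJ h, norm_smul, Complex.norm_real, Real.norm_of_nonneg hr.le] at h1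
  rwa [le_div_iff₀' hr]

/-- The resolvents `(1 + K / (n + 1))⁻¹` converge strongly to the identity. -/
lemma tendsto_resolvent (hG : IsPositiveSelfAdjointGraph G) {J : ℕ → E →L[ℂ] E}
    (hJ : ∀ (n : ℕ) (u : E), (J n u, (((n : ℝ) + 1 : ℝ) : ℂ) • (u - J n u)) ∈ G) (x : E) :
    Tendsto (fun n => J n x) atTop (𝓝 x) := by
  rw [Metric.tendsto_atTop]
  intro ε hε
  obtain ⟨y, ⟨k, hk⟩, hy⟩ := hG.dense.exists_dist_lt x (show 0 < ε / 3 by positivity)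
  obtain ⟨N, hN⟩ := exists_nat_gt (‖k‖ / (ε / 3))
  refine ⟨N, fun n hn => ?_⟩
  have hr : (0 : ℝ) < n + 1 := by positivity
  have h1 := hG.norm_resolvent_le hr (hJ n) (x - y)
  have h2 : ‖y - J n y‖ < ε / 3 := by
    refine (hG.norm_sub_resolvent_le hr (hJ n) hk).trans_lt ?_
    have : (N : ℝ) ≤ n := by exact_mod_cast hn
    rw [div_lt_iff₀ (by positivity)] at hN
    rw [div_lt_iff₀ hr]
    nlinarith
  rw [dist_eq_norm] at hy ⊢
  rw [norm_sub_rev] at h2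
  have h3 : J n x - x = J n (x - y) + (J n y - y) - (x - y) := by rw [map_sub]; abel
  rw [h3]
  calc _ ≤ ‖J n (x - y) + (J n y - y)‖ + ‖x - y‖ := norm_sub_le _ _
    _ ≤ ‖J n (x - y)‖ + ‖J n y - y‖ + ‖x - y‖ := by gcongr; exact norm_add_le _ _
    _ < ε := by linarith

variable [CompleteSpace E]

lemma norm_exp_yosida_apply_le (hG : IsPositiveSelfAdjointGraph G) {r : ℝ} (hr : 0 < r)
    {J : E →L[ℂ] E} (hJ : ∀ u, (J u, (r : ℂ) • (u - J u)) ∈ G) {z : ℂ} (hz : 0 ≤ z.re) (u : E) :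
    ‖NormedSpace.exp (z • -yosida r J) u‖ ≤ ‖u‖ := by
  simpa using norm_exp_smul_apply_le (hG.dissipative_yosida hr hJ hz) zero_le_one u

lemma norm_exp_yosida_sub_le (hG : IsPositiveSelfAdjointGraph G) {r s : ℝ} (hr : 0 < r)
    (hs : 0 < s) {J L : E →L[ℂ] E} (hJ : ∀ u, (J u, (r : ℂ) • (u - J u)) ∈ G)
    (hL : ∀ u, (L u, (s : ℂ) • (u - L u)) ∈ G) {z : ℂ} (hz : 0 ≤ z.re) (u : E) :
    ‖NormedSpace.exp (z • -yosida r J) u - NormedSpace.exp (z • -yosida s L) u‖ ≤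
      ‖z‖ * ‖yosida s L u - yosida r J u‖ := by
  set B := yosida r J with hB
  set C := yosida s L with hC
  have hcomm : Commute (z • (C - B)) (z • -B) :=
    (((hG.commute_yosida hs hr hL hJ).sub_left (Commute.refl _)).neg_right.smul_left _).smul_right _
  have hexp : ∀ t : ℝ, HasDerivAt (fun t : ℝ => NormedSpace.exp (t • (z • -B)) u)
      ((z • -C) (NormedSpace.exp (t • (z • -B)) u) +
        NormedSpace.exp (t • (z • -B)) ((z • (C - B)) u)) t := by
    intro t
    have h := hasDerivAt_clm_apply (hasDerivAt_exp_smul_const' (z • -B) t) (hasDerivAt_const t u)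
    convert h using 1
    have h1 : Commute (z • (C - B)) (NormedSpace.exp (t • (z • -B))) :=
      (hcomm.smul_right t).exp_right
    have h2 := congrArg (fun T : E →L[ℂ] E => T u) h1.eq
    simp only [mul_apply_eq_comp] at h2
    rw [← h2]
    simp [smul_sub]
    abel
  have := norm_sub_exp_apply_le (hG.dissipative_yosida hs hL hz) hexp
    (δ := ‖z‖ * ‖C u - B u‖) fun t ht => by
      refine (norm_exp_smul_apply_le (hG.dissipative_yosida hr hJ hz) ht _).trans_eq ?_
      rw [smul_apply, norm_smul, sub_apply]
  simpa using this

/-- On the domain of `K`, the unitary group generated by the Yosida approximation is close to the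
unitary group `W` generated by `K`. -/
lemma norm_group_sub_exp_yosida_le (hG : IsPositiveSelfAdjointGraph G) {W : ℝ → E →ₗᵢ[ℂ] E}
    (hW0 : ∀ x, W 0 x = x) (hWG : ∀ t x y, (x, y) ∈ G → (W t x, W t y) ∈ G)
    (hWd : ∀ x y, (x, y) ∈ G → ∀ t, HasDerivAt (fun t => W t x) (-Complex.I • W t y) t)
    {r : ℝ} (hr : 0 < r) {J : E →L[ℂ] E} (hJ : ∀ u, (J u, (r : ℂ) • (u - J u)) ∈ G)
    {x y : E} (h : (x, y) ∈ G) (t : ℝ) :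
    ‖W t x - NormedSpace.exp ((Complex.I * t) • -yosida r J) x‖ ≤ |t| * ‖yosida r J x - y‖ := by
  set B := yosida r J with hB
  have hBW : ∀ (s : ℝ) (u : E), B (W s u) = W s (B u) := fun s u => by
    have hJW : J (W s u) = W s (J u) := hG.resolvent_comm hr hJ (W s).toLinearMap (hWG s) u
    rw [hB, yosida_apply, yosida_apply, map_smul, map_sub, hJW]
  have hd : ∀ s : ℝ, HasDerivAt (fun s : ℝ => W (s * t) x)
      (((Complex.I * t) • -B) (W (s * t) x) + (Complex.I * t) • W (s * t) (B x - y)) s := by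
    intro s
    have h1 : HasDerivAt (fun s : ℝ => W (s * t) x) ((1 * t) • (-Complex.I • W (s * t) y)) s :=
      HasDerivAt.scomp (g₁ := fun t => W t x) (h := fun s : ℝ => s * t) s (hWd x y h (s * t))
        ((hasDerivAt_id s).mul_const t)
    convert h1 using 1
    simp only [smul_apply, neg_apply, hBW, map_sub,
      smul_neg, smul_sub, one_mul, neg_smul, mul_smul]
    rw [Complex.coe_smul, Complex.coe_smul, smul_comm t Complex.I]
    abel
  have := norm_sub_exp_apply_le (hG.dissipative_yosida hr hJ (z := Complex.I * t) (by simp)) hd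
    (δ := |t| * ‖B x - y‖) fun s _ => by
      rw [norm_smul, LinearIsometry.norm_map]
      simp
  simpa [hW0] using this

/-- The Yosida semigroups `exp (-z Bₙ)` converge strongly, uniformly on bounded subsets of the
closed right half-plane. -/
lemma uniformCauchySeqOn_exp_yosida (hG : IsPositiveSelfAdjointGraph G) {J : ℕ → E →L[ℂ] E}
    (hJ : ∀ (n : ℕ) (u : E), (J n u, (((n : ℝ) + 1 : ℝ) : ℂ) • (u - J n u)) ∈ G) (x : E) (ρ : ℝ) :
    UniformCauchySeqOn (fun (n : ℕ) (z : ℂ) => NormedSpace.exp (z • -yosida (n + 1) (J n)) x) atTop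
      {z | 0 ≤ z.re ∧ ‖z‖ ≤ ρ} := by
  rw [Metric.uniformCauchySeqOn_iff]
  intro ε hε
  have hr : ∀ n : ℕ, (0 : ℝ) < n + 1 := fun n => by positivity
  obtain ⟨y, ⟨k, hk⟩, hy⟩ := hG.dense.exists_dist_lt x (show 0 < ε / 3 by positivity)
  obtain ⟨N, hN⟩ := Metric.cauchySeq_iff.1 (hG.tendsto_resolvent hJ k).cauchySeq
    (ε / 3 / (|ρ| + 1)) (by positivity)
  refine ⟨N, fun m hm n hn z ⟨hz, hzρ⟩ => ?_⟩
  have h1 := hG.norm_exp_yosida_apply_le (hr m) (hJ m) hz (x - y)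
  have h2 := hG.norm_exp_yosida_apply_le (hr n) (hJ n) hz (x - y)
  have h3 := hG.norm_exp_yosida_sub_le (hr m) (hr n) (hJ m) (hJ n) hz y
  have h4 := hN n hn m hm
  rw [hG.yosida_eq (hr m) (hJ m) hk, hG.yosida_eq (hr n) (hJ n) hk] at h3
  rw [dist_eq_norm] at hy h4 ⊢
  rw [lt_div_iff₀ (by positivity)] at h4
  have h5 : ‖z‖ * ‖J n k - J m k‖ < ε / 3 := by
    have := le_abs_self ρ
    nlinarith [norm_nonneg (J n k - J m k)]
  rw [map_sub] at h1 h2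
  set a := NormedSpace.exp (z • -yosida (m + 1) (J m)) x
  set b := NormedSpace.exp (z • -yosida (n + 1) (J n)) x
  set c := NormedSpace.exp (z • -yosida (m + 1) (J m)) y
  set d := NormedSpace.exp (z • -yosida (n + 1) (J n)) y
  have h6 : a - b = (a - c) + (c - d) - (b - d) := by abel
  rw [h6]
  calc _ ≤ ‖(a - c) + (c - d)‖ + ‖b - d‖ := norm_sub_le _ _
    _ ≤ ‖a - c‖ + ‖c - d‖ + ‖b - d‖ := by gcongr; exact norm_add_le _ _
    _ < ε := by linarith

lemma tendsto_exp_yosida_group (hG : IsPositiveSelfAdjointGraph G) {W : ℝ → E →ₗᵢ[ℂ] E}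
    (hW0 : ∀ x, W 0 x = x) (hWG : ∀ t x y, (x, y) ∈ G → (W t x, W t y) ∈ G)
    (hWd : ∀ x y, (x, y) ∈ G → ∀ t, HasDerivAt (fun t => W t x) (-Complex.I • W t y) t)
    {J : ℕ → E →L[ℂ] E}
    (hJ : ∀ (n : ℕ) (u : E), (J n u, (((n : ℝ) + 1 : ℝ) : ℂ) • (u - J n u)) ∈ G) (x : E) (t : ℝ) :
    Tendsto (fun n : ℕ => NormedSpace.exp ((Complex.I * t) • -yosida (n + 1) (J n)) x) atTop
      (𝓝 (W t x)) := by
  rw [Metric.tendsto_atTop]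
  intro ε hε
  have hr : ∀ n : ℕ, (0 : ℝ) < n + 1 := fun n => by positivity
  obtain ⟨y, ⟨k, hk⟩, hy⟩ := hG.dense.exists_dist_lt x (show 0 < ε / 3 by positivity)
  obtain ⟨N, hN⟩ := Metric.tendsto_atTop.1 (hG.tendsto_resolvent hJ k)
    (ε / 3 / (|t| + 1)) (by positivity)
  refine ⟨N, fun n hn => ?_⟩
  have h2 := hG.norm_exp_yosida_apply_le (hr n) (hJ n) (z := Complex.I * t) (by simp) (x - y)
  have h3 := hG.norm_group_sub_exp_yosida_le hW0 hWG hWd (hr n) (hJ n) hk t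
  have h4 := hN n hn
  have h1 := (W t).norm_map (x - y)
  rw [hG.yosida_eq (hr n) (hJ n) hk] at h3
  rw [dist_eq_norm] at hy h4 ⊢
  rw [lt_div_iff₀ (by positivity)] at h4
  have h5 : |t| * ‖J n k - k‖ < ε / 3 := by
    nlinarith [norm_nonneg (J n k - k)]
  rw [map_sub] at h1 h2
  set b := NormedSpace.exp ((Complex.I * t) • -yosida (n + 1) (J n)) x
  set d := NormedSpace.exp ((Complex.I * t) • -yosida (n + 1) (J n)) y
  have h6 : b - W t x = (b - d) - (W t y - d) - (W t x - W t y) := by abel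
  rw [h6]
  calc _ ≤ ‖(b - d) - (W t y - d)‖ + ‖W t x - W t y‖ := norm_sub_le _ _
    _ ≤ ‖b - d‖ + ‖W t y - d‖ + ‖W t x - W t y‖ := by gcongr; exact norm_sub_le _ _
    _ < ε := by linarith

/-- The orbits of the unitary group `W t = exp (-i t K)` of a positive operator `K` continue to the
right half-plane: `F z = exp (-z K) x` is continuous for `0 ≤ re z`, holomorphic for `0 < re z`,
and equals `W t x` at `z = i t`. It is the limit of the entire functions `exp (-z Bₙ) x`, with `Bₙ`
the Yosida approximations of `K`. -/
theorem exists_holomorphic_continuation (hG : IsPositiveSelfAdjointGraph G) {W : ℝ → E →ₗᵢ[ℂ] E}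
    (hW0 : ∀ x, W 0 x = x) (hWG : ∀ t x y, (x, y) ∈ G → (W t x, W t y) ∈ G)
    (hWd : ∀ x y, (x, y) ∈ G → ∀ t, HasDerivAt (fun t => W t x) (-Complex.I • W t y) t) (x : E) :
    ∃ F : ℂ → E, ContinuousOn F {z | 0 ≤ z.re} ∧ DifferentiableOn ℂ F {z | 0 < z.re} ∧
      ∀ t : ℝ, F (Complex.I * t) = W t x := by
  have hr : ∀ n : ℕ, (0 : ℝ) < n + 1 := fun n => by positivity
  choose J hJ _ using fun n : ℕ => hG.exists_resolvent (hr n)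
  let Φ : ℕ → ℂ → E := fun n z => NormedSpace.exp (z • -yosida (n + 1) (J n)) x
  have hΦd : ∀ n, Differentiable ℂ (Φ n) := fun n z =>
    ((hasDerivAt_exp_smul_const (-yosida (n + 1) (J n)) z).clm_apply
      (hasDerivAt_const z x)).differentiableAt
  have hcau : ∀ ρ, UniformCauchySeqOn Φ atTop {z | 0 ≤ z.re ∧ ‖z‖ ≤ ρ} :=
    hG.uniformCauchySeqOn_exp_yosida hJ x
  have hlim : ∀ z : ℂ, ∃ y, 0 ≤ z.re → Tendsto (fun n => Φ n z) atTop (𝓝 y) := fun z => by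
    by_cases hz : 0 ≤ z.re
    · obtain ⟨y, hy⟩ := cauchySeq_tendsto_of_complete
        ((hcau ‖z‖).cauchySeq (x := z) ⟨hz, le_rfl⟩)
      exact ⟨y, fun _ => hy⟩
    · exact ⟨0, fun h => absurd h hz⟩
  choose F hF using hlim
  have hloc : TendstoLocallyUniformlyOn Φ F atTop {z | 0 ≤ z.re} := by
    intro u hu z hz
    refine ⟨{w | 0 ≤ w.re ∧ ‖w‖ ≤ ‖z‖ + 1}, ?_,
      (hcau (‖z‖ + 1)).tendstoUniformlyOn_of_tendsto (fun w hw => hF w hw.1) u hu⟩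
    have : {w : ℂ | ‖w‖ < ‖z‖ + 1} ∈ 𝓝 z :=
      (isOpen_lt continuous_norm continuous_const).mem_nhds (by simp)
    filter_upwards [self_mem_nhdsWithin, nhdsWithin_le_nhds this] with w h1 h2
    exact ⟨h1, le_of_lt h2⟩
  refine ⟨F, hloc.continuousOn (Frequently.of_forall fun n => (hΦd n).continuous.continuousOn),
    ?_, fun t => ?_⟩
  · exact (hloc.mono fun z (hz : 0 < z.re) => hz.le).differentiableOn
      (Eventually.of_forall fun n => (hΦd n).differentiableOn)
      (isOpen_lt continuous_const Complex.continuous_re)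
  · exact tendsto_nhds_unique (hF _ (by simp)) (hG.tendsto_exp_yosida_group hW0 hWG hWd hJ x t)

end IsPositiveSelfAdjointGraph

/-- If an orbit of `exp (-i t K)`, with `K` positive, lies in a closed subspace during some interval
of time, then it lies there at all times. -/
theorem mem_of_mem_on_interval [CompleteSpace E] {G : Submodule ℂ (E × E)}
    (hG : IsPositiveSelfAdjointGraph G) {W : ℝ → E →ₗᵢ[ℂ] E}
    (hW0 : ∀ x, W 0 x = x) (hWG : ∀ t x y, (x, y) ∈ G → (W t x, W t y) ∈ G)
    (hWd : ∀ x y, (x, y) ∈ G → ∀ t, HasDerivAt (fun t => W t x) (-Complex.I • W t y) t)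
    {V : Submodule ℂ E} (hV : IsClosed (V : Set E)) {x : E} {a b : ℝ} (hab : a < b)
    (hx : ∀ t ∈ Set.Ioo a b, W t x ∈ V) (t : ℝ) : W t x ∈ V := by
  obtain ⟨F, hFc, hFd, hFW⟩ := hG.exists_holomorphic_continuation hW0 hWG hWd x
  have : CompleteSpace V := hV.completeSpace_coe
  rw [← V.orthogonal_orthogonal, Submodule.mem_orthogonal]
  intro w hw
  have h := eq_zero_of_eq_zero_on_boundary_interval (f := fun z => innerSL ℂ w (F z))
    ((innerSL ℂ w).continuous.comp_continuousOn hFc)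
    ((innerSL ℂ w).differentiable.comp_differentiableOn hFd) hab
    (fun s hs => by
      rw [hFW]
      exact (Submodule.mem_orthogonal' _ _).1 hw _ (hx s hs))
    (z := Complex.I * t) (by simp)
  simpa [hFW] using h

end Continuation

/-! ### Orbits of the Schrödinger evolution -/

section Evolution

variable {E : Type*} [NormedAddCommGroup E] [InnerProductSpace ℂ E]

/-- The graph of `H - c`. -/
def shiftedGraph (H : E →ₗ.[ℂ] E) (c : ℝ) : Submodule ℂ (E × E) :=
  H.graph.comap ((LinearMap.fst ℂ E E).prod (LinearMap.snd ℂ E E + (c : ℂ) • LinearMap.fst ℂ E E))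

lemma mem_shiftedGraph {H : E →ₗ.[ℂ] E} {c : ℝ} {x y : E} :
    (x, y) ∈ shiftedGraph H c ↔ (x, y + (c : ℂ) • x) ∈ H.graph := Iff.rfl

lemma sub_mem_shiftedGraph {H : E →ₗ.[ℂ] E} {c : ℝ} {x y : E} (h : (x, y) ∈ H.graph) :
    (x, y - (c : ℂ) • x) ∈ shiftedGraph H c := by
  rwa [mem_shiftedGraph, sub_add_cancel]

lemma isPositiveSelfAdjointGraph_shiftedGraph [CompleteSpace E] {H : E →ₗ.[ℂ] E}
    (hH : IsSelfAdjoint H) {c : ℝ}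
    (hc : ∀ x : H.domain, c * ‖(x : E)‖ ^ 2 ≤ RCLike.re (inner ℂ (x : E) (H x))) :
    IsPositiveSelfAdjointGraph (shiftedGraph H c) := by
  have hadj : ∀ x y : E, (x, y) ∈ H.graph ↔
      ∀ a b : E, (a, b) ∈ H.graph → inner ℂ b x - inner ℂ a y = 0 := fun x y => by
    have h := LinearPMap.adjoint_graph_eq_graph_adjoint hH.dense_domain
    rw [LinearPMap.isSelfAdjoint_def.1 hH] at h
    conv_lhs => rw [h]
    exact Submodule.mem_adjoint_iff _ _
  refine ⟨?_, fun x y => ?_, fun x y h => ?_⟩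
  · refine hH.dense_domain.mono fun x hx => ?_
    obtain ⟨y, hy⟩ := LinearPMap.mem_domain_iff.1 hx
    exact ⟨_, sub_mem_shiftedGraph hy⟩
  · rw [mem_shiftedGraph, hadj]
    constructor
    · intro h a b hab
      have := h a _ (mem_shiftedGraph.1 hab)
      simp only [inner_add_left, inner_add_right, inner_smul_left, inner_smul_right,
        Complex.conj_ofReal] at this
      linear_combination this
    · intro h a b hab
      have := h a _ (sub_mem_shiftedGraph hab)
      simp only [inner_sub_left, inner_smul_left, Complex.conj_ofReal] at this
      simp only [inner_add_right, inner_smul_right]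
      linear_combination this
  · obtain ⟨u, hu, hy⟩ := (LinearPMap.mem_graph_iff _).1 (mem_shiftedGraph.1 h)
    have h1 := hc u
    dsimp only at hu hy
    rw [hy, hu, inner_add_right, inner_smul_right] at h1
    simp only [RCLike.re_to_complex, Complex.add_re, Complex.re_ofReal_mul] at h1
    have h2 : (inner ℂ x x).re = ‖x‖ ^ 2 := inner_self_eq_norm_sq (𝕜 := ℂ) x
    rw [h2] at h1
    linarith

namespace IsSchrodingerEvolution

variable {hbar : ℝ} {H : E →ₗ.[ℂ] E} {U : ℝ → E ≃ₗᵢ[ℂ] E}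

lemma apply_comm (hU : IsSchrodingerEvolution hbar H U) (s t : ℝ) (x : E) :
    U s (U t x) = U t (U s x) := by
  rw [← hU.map_add, ← hU.map_add, add_comm]

lemma graph_invariant (hU : IsSchrodingerEvolution hbar H U) (t : ℝ) {x y : E}
    (h : (x, y) ∈ H.graph) : (U t x, U t y) ∈ H.graph := by
  rw [hU.mem_graph_iff] at h ⊢
  have h1 := (((U t).toContinuousLinearEquiv : E →L[ℂ] E).restrictScalars
    ℝ).hasFDerivAt.comp_hasDerivAt (0 : ℝ) h
  have h2 : (fun s => U s (U t x)) = (fun s => U t (U s x)) := funext fun s => hU.apply_comm s t x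
  rw [h2, ← map_smul]
  exact h1

lemma hasDerivAt (hU : IsSchrodingerEvolution hbar H U) {x y : E} (h : (x, y) ∈ H.graph) (t : ℝ) :
    HasDerivAt (fun t => U t x) (-(Complex.I / (hbar : ℂ)) • U t y) t := by
  have h1 := (hU.mem_graph_iff _ _).1 (hU.graph_invariant t h)
  have h2 : (fun s => U s x) = fun s => U (s - t) (U t x) := funext fun s => by
    rw [← hU.map_add, sub_add_cancel]
  rw [h2]
  rw [← sub_self t] at h1
  exact h1.comp_sub_const t t

/-- For a Hamiltonian that is bounded from below: an orbit that lies in a closed subspace during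
some interval of time lies there at all times. -/
theorem mem_of_mem_on_interval [CompleteSpace E] (hU : IsSchrodingerEvolution hbar H U)
    (hhbar : 0 < hbar) (hH : IsSelfAdjoint H) (hHbdd : IsBoundedBelow H) {V : Submodule ℂ E}
    (hV : IsClosed (V : Set E)) {x : E} {a b : ℝ} (hab : a < b)
    (hx : ∀ t ∈ Set.Ioo a b, U t x ∈ V) (t : ℝ) : U t x ∈ V := by
  obtain ⟨c, hc⟩ := hHbdd
  have hb : (hbar : ℂ) ≠ 0 := by exact_mod_cast hhbar.ne'
  -- the group generated by `H - c`, in units of time with `ℏ = 1`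
  let W : ℝ → E →ₗᵢ[ℂ] E := fun t =>
    { toLinearMap :=
        Complex.exp ((c * t : ℝ) * Complex.I) • (U (hbar * t)).toLinearEquiv.toLinearMap
      norm_map' := fun u => by
        change ‖Complex.exp ((c * t : ℝ) * Complex.I) • U (hbar * t) u‖ = ‖u‖
        rw [norm_smul, Complex.norm_exp_ofReal_mul_I, one_mul, LinearIsometryEquiv.norm_map] }
  have hW : ∀ t u, W t u = Complex.exp ((c * t : ℝ) * Complex.I) • U (hbar * t) u := fun _ _ => rfl
  have hWG : ∀ t x y, (x, y) ∈ shiftedGraph H c → (W t x, W t y) ∈ shiftedGraph H c := by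
    intro t x y h
    have h1 := H.graph.smul_mem (Complex.exp ((c * t : ℝ) * Complex.I))
      (hU.graph_invariant (hbar * t) (mem_shiftedGraph.1 h))
    rw [mem_shiftedGraph, ← map_smul, ← _root_.map_add]
    exact h1
  have hWd : ∀ x y, (x, y) ∈ shiftedGraph H c →
      ∀ t, HasDerivAt (fun t => W t x) (-Complex.I • W t y) t := by
    intro x y h t
    have h1 : HasDerivAt (fun t : ℝ => U (hbar * t) x)
        ((hbar * 1) • (-(Complex.I / (hbar : ℂ)) • U (hbar * t) (y + (c : ℂ) • x))) t :=
      HasDerivAt.scomp (g₁ := fun t => U t x) (h := fun t : ℝ => hbar * t) t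
        (hU.hasDerivAt (mem_shiftedGraph.1 h) (hbar * t)) ((hasDerivAt_id t).const_mul hbar)
    have h2 : HasDerivAt (fun t : ℝ => Complex.exp ((c * t : ℝ) * Complex.I))
        (Complex.exp ((c * t : ℝ) * Complex.I) * (((c * 1 : ℝ) : ℂ) * Complex.I)) t :=
      ((((hasDerivAt_id t).const_mul c).ofReal_comp).mul_const Complex.I).cexp
    refine (h2.smul h1).congr_deriv ?_
    rw [hW, _root_.map_add, map_smul, ← Complex.coe_smul, mul_one, mul_one]
    match_scalars <;> field_simp
    ring
  have key := _root_.mem_of_mem_on_interval (isPositiveSelfAdjointGraph_shiftedGraph hH hc) (W := W)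
    (fun x => by rw [hW]; simp [hU.map_zero]) hWG hWd hV (x := x)
    ((div_lt_div_iff_of_pos_right hhbar).2 hab) (fun s hs => by
      rw [hW]
      refine V.smul_mem _ (hx _ ⟨?_, ?_⟩)
      · exact (div_lt_iff₀' hhbar).1 hs.1
      · exact (lt_div_iff₀' hhbar).1 hs.2) (t / hbar)
  rw [hW, mul_div_cancel₀ _ hhbar.ne'] at key
  exact (V.smul_mem_iff (Complex.exp_ne_zero _)).1 key

end IsSchrodingerEvolution

end Evolution

/-! ### Pointer records -/

section Records

variable {HS HM : Type*}
  [NormedAddCommGroup HS] [InnerProductSpace ℂ HS]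
  [NormedAddCommGroup HM] [InnerProductSpace ℂ HM]

lemma inner_productVec (ψ ψ' : HS) (φ φ' : HM) :
    inner ℂ (productVec ψ φ) (productVec ψ' φ') = inner ℂ ψ ψ' * inner ℂ φ φ' := by
  rw [productVec, productVec, UniformSpace.Completion.inner_coe, TensorProduct.inner_tmul]

lemma norm_productVec (ψ : HS) (φ : HM) : ‖productVec ψ φ‖ = ‖ψ‖ * ‖φ‖ := by
  rw [productVec, UniformSpace.Completion.norm_coe, TensorProduct.norm_tmul]

lemma isClosed_recordSpace (Q : HM →L[ℂ] HM) :
    IsClosed (recordSpace HS Q : Set (CombinedSpace HS HM)) :=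
  Submodule.isClosed_topologicalClosure _

lemma IsSharpObservable.inner_eq_zero {E : Type*} [NormedAddCommGroup E] [InnerProductSpace ℂ E]
    [CompleteSpace E] {A : E →ₗ.[ℂ] E} {P : ℝ → E →L[ℂ] E} (hA : IsSharpObservable A P) {l m : ℝ}
    (hlm : l ≠ m) {x y : E} (hx : P l x = x) (hy : P m y = y) : inner ℂ x y = 0 := by
  have h1 : ContinuousLinearMap.adjoint (P l) = P l := (hA.isStarProjection l).isSelfAdjoint
  have h2 : P l (P m y) = 0 := by
    have := congrArg (fun T : E →L[ℂ] E => T y) (hA.mul_eq_zero l m hlm)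
    simpa using this
  rw [← hx, ← h1, ContinuousLinearMap.adjoint_inner_left, ← hy, h2, inner_zero_right]

/-- Product vectors whose pointer factor has the value `m` are orthogonal to the records `l ≠ m`. -/
lemma inner_productVec_eq_zero [CompleteSpace HM] {Z : HM →ₗ.[ℂ] HM} {Q : ℝ → HM →L[ℂ] HM}
    (hZ : IsSharpObservable Z Q) {l m : ℝ} (hlm : l ≠ m) (ψ : HS) {φ : HM} (hφ : Q m φ = φ)
    {v : CombinedSpace HS HM} (hv : v ∈ recordSpace HS (Q l)) :
    inner ℂ (productVec ψ φ) v = 0 := by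
  have hle : recordSpace HS (Q l) ≤ (Submodule.span ℂ {productVec ψ φ})ᗮ := by
    refine Submodule.topologicalClosure_minimal _ (Submodule.span_le.2 ?_)
      (Submodule.isClosed_orthogonal _)
    rintro _ ⟨ψ', φ', hφ', rfl⟩
    rw [SetLike.mem_coe, Submodule.mem_orthogonal_singleton_iff_inner_right, inner_productVec,
      hZ.inner_eq_zero hlm.symm hφ hφ', mul_zero]
  exact (Submodule.mem_orthogonal_singleton_iff_inner_right).1 (hle hv)

/-- A record that persists during `(T, T')` was there at all times: propagated back from time `T` to
time `0`, the state lies in the same record space. -/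
lemma PointerPersists.symm_apply_mem [CompleteSpace HS] [CompleteSpace HM] {hbar : ℝ}
    (hhbar : 0 < hbar) {H : CombinedSpace HS HM →ₗ.[ℂ] CombinedSpace HS HM} (hH : IsSelfAdjoint H)
    (hHbdd : IsBoundedBelow H) {U : ℝ → CombinedSpace HS HM ≃ₗᵢ[ℂ] CombinedSpace HS HM}
    (hU : IsSchrodingerEvolution hbar H U) {Q : HM →L[ℂ] HM} {T T' : ℝ} (hTT' : T < T')
    {Ψ : CombinedSpace HS HM} (h : PointerPersists U Q T T' Ψ) :
    (U T).symm Ψ ∈ recordSpace HS Q := by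
  have h1 := hU.mem_of_mem_on_interval hhbar hH hHbdd (isClosed_recordSpace Q) (x := Ψ)
    (sub_pos.2 hTT') (fun s hs => by
      have := h (s + T) ⟨by linarith [hs.1], by linarith [hs.2]⟩
      rwa [add_sub_cancel_right] at this) (-T)
  have h2 : (U T).symm Ψ = U (-T) Ψ := by
    rw [LinearIsometryEquiv.symm_apply_eq, ← hU.map_add, add_neg_cancel, hU.map_zero]
  rwa [h2]

lemma IsSharpObservable.exists_eigenvector {E : Type*} [NormedAddCommGroup E]
    [InnerProductSpace ℂ E] [CompleteSpace E] [Nontrivial E] {A : E →ₗ.[ℂ] E} {P : ℝ → E →L[ℂ] E}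
    (hA : IsSharpObservable A P) : ∃ (l : ℝ) (x : E), ‖x‖ = 1 ∧ P l x = x := by
  obtain ⟨x, hx⟩ := exists_ne (0 : E)
  obtain ⟨l, hl⟩ : ∃ l, P l x ≠ 0 := by
    by_contra! h
    have h1 := hA.hasSum_proj x
    simp only [h] at h1
    exact hx (h1.unique hasSum_zero)
  refine ⟨l, (‖P l x‖⁻¹ : ℂ) • P l x, norm_smul_inv_norm hl, ?_⟩
  have h2 := congrArg (fun T : E →L[ℂ] E => T x) (hA.isStarProjection l).isIdempotentElem.eq
  simp only [mul_apply_eq_comp] at h2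
  rw [map_smul, h2]

end Records

theorem theorem1 {HS HM : Type*}
    [NormedAddCommGroup HS] [InnerProductSpace ℂ HS] [CompleteSpace HS] [Nontrivial HS]
    [NormedAddCommGroup HM] [InnerProductSpace ℂ HM] [CompleteSpace HM]
    -- the total Hamiltonian and the evolution that it generates
    (hbar : ℝ) (hhbar : 0 < hbar)
    (H : CombinedSpace HS HM →ₗ.[ℂ] CombinedSpace HS HM)
    (hH : IsSelfAdjoint H) (hHbdd : IsBoundedBelow H)
    (U : ℝ → CombinedSpace HS HM ≃ₗᵢ[ℂ] CombinedSpace HS HM)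
    (hU : IsSchrodingerEvolution hbar H U)
    -- the measured observable and the pointer observable
    (A : HS →ₗ.[ℂ] HS) (P : ℝ → HS →L[ℂ] HS) (hA : IsSharpObservable A P)
    (Z : HM →ₗ.[ℂ] HM) (Q : ℝ → HM →L[ℂ] HM) (hZ : IsSharpObservable Z Q)
    -- the ready state, for a pointer value which is not an eigenvalue of the measured observable
    (ready : ℝ) (hready : P ready = 0)
    (φ₀ : HM) (hφ₀ : ‖φ₀‖ = 1) (hφ₀_ready : Q ready φ₀ = φ₀)
    -- the time at which the pointer is read, and the end of the time during which it is readable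
    (T T' : ℝ) (hTT' : T < T') :
    ¬ (IsAccurateMeasurement U P Q φ₀ T ∧ MeasurementPersists U P Q φ₀ T T') ∧
    ∀ ψ₀ : HS, ‖ψ₀‖ = 1 →
      ¬ ∃ (c : ℝ → ℂ) (ψT : ℝ → HS) (φT : ℝ → HM),
        IsAccuratePreparation U P Q φ₀ T ψ₀ c ψT φT ∧ PreparationPersists U Q T T' c ψT φT := by
  have hne : ∀ (l : ℝ) (ψ : HS), ‖ψ‖ = 1 → P l ψ = ψ → l ≠ ready := by
    rintro l ψ hψ hl rfl
    rw [hready, zero_apply] at hl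
    rw [← hl, norm_zero] at hψ
    exact zero_ne_one hψ
  have hself : ∀ ψ : HS, ‖ψ‖ = 1 →
      inner ℂ (productVec ψ φ₀) (productVec ψ φ₀) ≠ (0 : ℂ) := fun ψ hψ h => by
    have := inner_self_eq_zero.1 h
    rw [← norm_eq_zero, norm_productVec, hψ, hφ₀, one_mul] at this
    exact one_ne_zero this
  refine ⟨?_, ?_⟩
  · rintro ⟨-, hpers⟩
    obtain ⟨l, ψ, hψ, hl⟩ := hA.exists_eigenvector
    have h := (hpers l ψ hψ hl).symm_apply_mem hhbar hH hHbdd hU hTT'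
    rw [LinearIsometryEquiv.symm_apply_apply] at h
    exact hself ψ hψ (inner_productVec_eq_zero hZ (hne l ψ hψ hl) ψ hφ₀_ready h)
  · rintro ψ₀ hψ₀ ⟨c, ψT, φT, ⟨hout, hsum⟩, hpers⟩
    have h1 := (hsum.mapL ((U T).symm.toContinuousLinearEquiv :
      CombinedSpace HS HM →L[ℂ] CombinedSpace HS HM)).mapL (innerSL ℂ (productVec ψ₀ φ₀))
    have h2 : ∀ l, innerSL ℂ (productVec ψ₀ φ₀)
        ((U T).symm (c l • productVec (ψT l) (φT l))) = 0 := fun l => by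
      by_cases hl : c l = 0
      · simp [hl]
      · obtain ⟨hn, hP, -, -⟩ := hout l hl
        have h := (hpers l hl).symm_apply_mem hhbar hH hHbdd hU hTT'
        rw [map_smul, map_smul, innerSL_apply_apply,
          inner_productVec_eq_zero hZ (hne l _ hn hP) ψ₀ hφ₀_ready h, smul_zero]
    have h3 : HasSum (fun _ : ℝ => (0 : ℂ))
        (innerSL ℂ (productVec ψ₀ φ₀) ((U T).symm (U T (productVec ψ₀ φ₀)))) := by
      rw [← funext h2]
      exact h1
    rw [LinearIsometryEquiv.symm_apply_apply] at h3
    exact hself ψ₀ hψ₀ (h3.unique hasSum_zero)
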